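/- Let $r\ge 1$ be an integer, let $P_1$ be a polynomial with real coefficients, and let $0<\vartheta<\tfrac12$ be fixed. For an integer $k\geq 1$ let $d_k(n)$ denote the coefficient of $n^{-s}$ in the Dirichlet series of $\zeta(s)^k$. For $T>1$ put $y=T^{\vartheta}$ and $$H_1(s)=\sum_{n\le y}\frac{d_{r+1}(n)P_1[n]}{n^{s}},\qquad P_1[n]=P_1\Big(\frac{\log (y/n)}{\log y}\Big).$$ Then, as $T\to\infty$, $$\int_T^{2T}\big|H_1(\tfrac12+it)\big|^2\,dt\;\sim\;\frac{a_{r+1}\,T\,(\log y)^{(r+1)^2}}{\Gamma((r+1)^2)}\int_0^1(1-x)^{(r+1)^2-1}P_1(x)^2\,dx,$$ where $$a_{k}=\prod_{p}\bigg(\Big(1-\frac1p\Big)^{k^2}\sum_{n\ge0}\frac{d_{k}(p^n)^2}{p^{n}}\bigg),$$ the product running over all primes; for $k=r+1$ the inner series converge for every prime $p$ and the product converges unconditionally. (If $P_1=0$, the relation $\sim$ means that both sides vanish for all large $T$.) -/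

import Mathlib

noncomputable section

namespace LargeGaps

/-- The generalized divisor function `d_r(n)`: the coefficient of `n ^ (-s)` in the Dirichlet
series of `ζ(s) ^ r`, i.e. the `r`-th power, under Dirichlet convolution, of the arithmetic
function with constant value `1` on the positive integers. -/
def d (r n : ℕ) : ℕ :=
  (ArithmeticFunction.zeta ^ r : ArithmeticFunction ℕ) n

/-- The smoothed weight `P[n] = P(log (y / n) / log y)`. -/
def weight (P : Polynomial ℝ) (y : ℝ) (n : ℕ) : ℝ :=
  P.eval (Real.log (y / n) / Real.log y)

/-- The Dirichlet polynomial `H₁(s) = ∑_{n ≤ y} d_{r+1}(n) P[n] n ^ (-s)`. -/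
def H₁ (r : ℕ) (P : Polynomial ℝ) (y : ℝ) (s : ℂ) : ℂ :=
  ∑ n ∈ Finset.Icc 1 ⌊y⌋₊, (d (r + 1) n : ℂ) * (weight P y n : ℂ) / (n : ℂ) ^ s

/-- The `n`-th term `d_r(p ^ n) ^ 2 / p ^ n` of the local series at `p`. -/
def localTerm (r p n : ℕ) : ℝ :=
  (d r (p ^ n) : ℝ) ^ 2 / (p : ℝ) ^ n

/-- The Euler factor `(1 - 1 / p) ^ (r ^ 2) * ∑_{n ≥ 0} d_r(p ^ n) ^ 2 / p ^ n`. -/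
def eulerFactor (r p : ℕ) : ℝ :=
  (1 - 1 / (p : ℝ)) ^ (r ^ 2) * ∑' n : ℕ, localTerm r p n

/-- The constant `a_r`, the product of the Euler factors over all primes. -/
def a (r : ℕ) : ℝ :=
  ∏' p : Nat.Primes, eulerFactor r p

end LargeGaps

end

/-! ### Divisor functions: size and summability. -/

namespace LargeGaps

open Filter Topology ArithmeticFunction

/-! Expanding the square, the integral is `T` times the diagonal sum `∑_{n ≤ y} d_{r+1}(n)² P[n]² /
n`, plus off-diagonal terms. The frequencies `log n` with `n ≤ y` are separated by at least `1 / y`,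
so bounding each oscillating integral trivially and applying Cauchy–Schwarz leaves an error of at
most `2 y²` times the diagonal (`abs_integral_norm_H₁_sq_sub_le`). This is negligible because `y² =
T ^ (2ϑ) = o(T)` when `ϑ < 1/2`.

For the diagonal, put `K = (r + 1)²`. Since `d_{r+1}(p)² = K`, the Dirichlet series of `d_{r+1}(n)²`
is `ζ ^ K` times an Euler product whose factors are `1 + O(p⁻²)`, uniformly down to the point `1`,
where the product equals `a_{r+1}`. This gives the pole in `tendsto_pow_mul_tsum_d_sq`. As the
coefficients are nonnegative, real-variable information suffices: Karamata's theorem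
(`tendsto_tsum_truncated`), applied with parameter `1 / log y`, turns the pole into the asymptotics
of the weighted sum over `n ≤ y` (`tendsto_diagonal`). For `P₁ ≠ 0` the limiting constant is
positive, so the limit of the quotient is an asymptotic equivalence. -/

lemma d_succ (k n : ℕ) : d (k + 1) n = ∑ e ∈ n.divisors, d k e := by
  unfold d
  rw [pow_succ, ArithmeticFunction.mul_zeta_apply]

lemma d_one (n : ℕ) : d 1 n = if n = 0 then 0 else 1 := by
  simp [d, ArithmeticFunction.zeta_apply]

lemma d_apply_zero (k : ℕ) : d k 0 = 0 := by simp [d]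

lemma d_isMultiplicative (k : ℕ) :
    (ArithmeticFunction.zeta ^ k : ArithmeticFunction ℕ).IsMultiplicative :=
  ArithmeticFunction.isMultiplicative_zeta.pow

lemma d_apply_one (k : ℕ) : d k 1 = 1 := (d_isMultiplicative k).1

lemma d_mul_of_coprime (k : ℕ) {m n : ℕ} (h : m.Coprime n) : d k (m * n) = d k m * d k n :=
  (d_isMultiplicative k).2 h

/-- Induction on `r` through the hockey-stick identity. -/
lemma d_succ_prime_pow (r n : ℕ) {p : ℕ} (hp : p.Prime) :
    d (r + 1) (p ^ n) = (n + r).choose r := by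
  induction r generalizing n with
  | zero => simp [d_one, hp.ne_zero]
  | succ r ih =>
    rw [d_succ, Nat.sum_divisors_prime_pow hp]
    simp only [ih]
    rw [Nat.sum_range_add_choose]
    congr 1

/-- Every divisor of `m * n` is a divisor of `m` times a divisor of `n`, possibly in several ways.
-/
lemma d_mul_le (k m n : ℕ) : d k (m * n) ≤ d k m * d k n := by
  induction k generalizing m n with
  | zero =>
    simp only [d, pow_zero, ArithmeticFunction.one_apply]
    split_ifs <;> simp_all
  | succ k ih =>
    simp only [d_succ]
    rw [Nat.divisors_mul, Finset.sum_mul_sum, ← Finset.sum_product', Finset.mul_def]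
    calc _ ≤ ∑ x ∈ m.divisors ×ˢ n.divisors, d k (x.1 * x.2) :=
          Finset.sum_image_le_of_nonneg (fun _ _ => Nat.zero_le _)
      _ ≤ _ := Finset.sum_le_sum fun x _ => ih x.1 x.2

/-- With `j = k` this gives `d_k² ≤ d_{k²}`, so the series of `d_k²` is dominated by that of `ζ ^
(k²)`. -/
lemma d_mul_d_le (j k n : ℕ) : d j n * d k n ≤ d (j * k) n := by
  induction k generalizing n with
  | zero =>
    simp only [d, pow_zero, mul_zero, ArithmeticFunction.one_apply]
    split_ifs with h
    · subst h; rw [(d_isMultiplicative j).1, mul_one]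
    · simp
  | succ k ih =>
    have h1 : d (j * (k + 1)) n = ∑ x ∈ n.divisorsAntidiagonal, d (j * k) x.1 * d j x.2 := by
      unfold d
      rw [mul_add, mul_one, pow_add, ArithmeticFunction.mul_apply]
    have h2 : d (k + 1) n = ∑ x ∈ n.divisorsAntidiagonal, d k x.1 := by
      rw [d_succ, Nat.sum_divisorsAntidiagonal (fun i _ => d k i)]
    rw [h1, h2, Finset.mul_sum]
    refine Finset.sum_le_sum fun x hx => ?_
    rw [← (Nat.mem_divisorsAntidiagonal.1 hx).1]
    calc d j (x.1 * x.2) * d k x.1 ≤ (d j x.1 * d j x.2) * d k x.1 := by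
          gcongr; exact d_mul_le _ _ _
      _ = (d j x.1 * d k x.1) * d j x.2 := by ring
      _ ≤ _ := by gcongr; exact ih _

lemma lseriesSummable_zeta_pow (k : ℕ) {s : ℂ} (hs : 1 < s.re) :
    LSeriesSummable (fun n => ((ArithmeticFunction.zeta : ArithmeticFunction ℂ) ^ k) n) s := by
  induction k with
  | zero =>
    refine summable_of_ne_finset_zero (s := {1}) fun n hn => ?_
    rw [Finset.mem_singleton] at hn
    rcases eq_or_ne n 0 with rfl | h0
    · simp
    · simp [LSeries.term_of_ne_zero h0, ArithmeticFunction.one_apply_ne hn]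
  | succ k ih =>
    rw [pow_succ]
    refine ArithmeticFunction.LSeriesSummable_mul ih ?_
    have := ArithmeticFunction.LSeriesSummable_zeta_iff.2 hs
    simpa using this

lemma summable_d_div_rpow (k : ℕ) {s : ℝ} (hs : 1 < s) :
    Summable fun n : ℕ => (d k n : ℝ) / (n : ℝ) ^ s := by
  have h := (lseriesSummable_zeta_pow k (s := (s : ℂ)) (by simpa using hs)).norm
  refine h.congr fun n => ?_
  rcases eq_or_ne n 0 with rfl | hn
  · simp [d_apply_zero]
  · have : ((ArithmeticFunction.zeta : ArithmeticFunction ℂ) ^ k) n = (d k n : ℂ) := by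
      unfold d
      rw [← ArithmeticFunction.natCoe_apply]
      congr 1
      clear h
      induction k with
      | zero => simp
      | succ k ih => rw [pow_succ, pow_succ, ih, ArithmeticFunction.natCoe_mul]
    rw [LSeries.term_of_ne_zero hn, this, norm_div, Complex.norm_natCast,
      Complex.norm_natCast_cpow_of_pos (Nat.pos_of_ne_zero hn)]
    simp

lemma summable_d_sq_div_rpow (k : ℕ) {s : ℝ} (hs : 1 < s) :
    Summable fun n : ℕ => (d k n : ℝ) ^ 2 / (n : ℝ) ^ s := by
  refine (summable_d_div_rpow (k * k) hs).of_nonneg_of_le (fun n => by positivity) fun n => ?_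
  gcongr
  rw [sq]
  exact_mod_cast d_mul_d_le k k n

/-! ### Local factors and the constant `a`. -/

/-- The power series `∑ C(n + r, r)² X ^ n` of the values `d_{r+1}(p ^ n) ^ 2`. -/
noncomputable def localSeries (r : ℕ) (X : ℝ) : ℝ := ∑' n : ℕ, ((n + r).choose r : ℝ) ^ 2 * X ^ n

/-- The normalized Euler factor as a function of `X = p ^ (-s)`. -/
noncomputable def localFactor (r : ℕ) (X : ℝ) : ℝ := (1 - X) ^ ((r + 1) ^ 2) * localSeries r X

lemma summable_localSeries (r : ℕ) {X : ℝ} (h0 : 0 < X) (h1 : X < 1) :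
    Summable fun n : ℕ => ((n + r).choose r : ℝ) ^ 2 * X ^ n := by
  have h := summable_pow_mul_geometric_of_norm_lt_one (2 * r) (r := X)
    (by rwa [Real.norm_of_nonneg h0.le])
  have h2 := ((summable_nat_add_iff r).2 h).mul_left ((X ^ r)⁻¹)
  refine h2.of_nonneg_of_le (fun n => by positivity) fun n => ?_
  have h3 : ((n + r).choose r : ℝ) ^ 2 ≤ ((n + r : ℕ) : ℝ) ^ (2 * r) := by
    rw [mul_comm 2 r, pow_mul]
    gcongr
    exact_mod_cast Nat.choose_le_pow (n + r) r
  calc _ ≤ ((n + r : ℕ) : ℝ) ^ (2 * r) * X ^ n := by gcongr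
    _ = _ := by rw [pow_add]; field_simp

lemma localSeries_pos (r : ℕ) {X : ℝ} (h0 : 0 < X) (h1 : X < 1) : 0 < localSeries r X :=
  (summable_localSeries r h0 h1).tsum_pos (fun n => by positivity) 0 (by simp)

lemma localFactor_pos (r : ℕ) {X : ℝ} (h0 : 0 < X) (h1 : X < 1) : 0 < localFactor r X :=
  mul_pos (pow_pos (by linarith) _) (localSeries_pos r h0 h1)

/-- The exponent `(r + 1)²` equals the coefficient of `X` in `localSeries`, so the linear terms
cancel. This quadratic bound drives the convergence of all products over primes below. -/
lemma exists_abs_localFactor_sub_one_le (r : ℕ) :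
    ∃ C : ℝ, ∀ X : ℝ, 0 < X → X ≤ 1 / 2 → |localFactor r X - 1| ≤ C * X ^ 2 := by
  set c : ℕ → ℝ := fun n => ((n + r).choose r : ℝ) ^ 2 with hc
  set K : ℕ := (r + 1) ^ 2 with hK
  set R : ℝ → ℝ := fun X => ∑' n : ℕ, c (n + 2) * X ^ n with hR
  have hsum (X : ℝ) (h0 : 0 < X) (h1 : X ≤ 1 / 2) : Summable fun n => c (n + 2) * X ^ n := by
    have h := (summable_localSeries r h0 (by linarith))
    refine (((summable_nat_add_iff 2).2 h).mul_left ((X ^ 2)⁻¹)).congr fun n => ?_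
    simp only [hc]
    rw [pow_add]; field_simp
  -- `R (1 / 2)` bounds the tail from degree two on, and `K ^ 2` is the loss in Bernoulli's
  -- inequality applied to `(1 - X) ^ K * (1 + K * X)`.
  refine ⟨R (1 / 2) + K ^ 2, fun X h0 h1 => ?_⟩
  have hS : localSeries r X = 1 + K * X + X ^ 2 * R X := by
    unfold localSeries
    rw [← (summable_localSeries r h0 (by linarith)).sum_add_tsum_nat_add 2]
    simp only [hR, ← tsum_mul_left]
    congr 1
    · simp [Finset.sum_range_succ, hK, add_comm 1 r]
    · refine tsum_congr fun n => ?_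
      simp only [hc]; ring
  have hR0 : 0 ≤ R X := tsum_nonneg fun n => by simp only [hc]; positivity
  have hR1 : R X ≤ R (1 / 2) := by
    refine (hsum X h0 h1).tsum_le_tsum (fun n => ?_) (hsum (1 / 2) (by norm_num) le_rfl)
    have : 0 ≤ c (n + 2) := by simp only [hc]; positivity
    gcongr
  have hp0 : 0 ≤ (1 - X) ^ K := pow_nonneg (by linarith) _
  have hp1 : (1 - X) ^ K ≤ 1 := pow_le_one₀ (by linarith) (by linarith)
  have hb1 : 1 - K * X ≤ (1 - X) ^ K := by
    have := one_add_mul_le_pow (a := -X) (by linarith) K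
    calc _ = 1 + K * -X := by ring
      _ ≤ _ := this
      _ = _ := by ring
  have hb2 : (1 - X) ^ K * (1 + K * X) ≤ 1 := by
    calc _ ≤ (1 - X) ^ K * (1 + X) ^ K := by
          gcongr; exact one_add_mul_le_pow (by linarith) K
      _ = (1 - X ^ 2) ^ K := by rw [← mul_pow]; ring
      _ ≤ 1 := pow_le_one₀ (by nlinarith) (by nlinarith)
  have hb3 : 1 - K ^ 2 * X ^ 2 ≤ (1 - X) ^ K * (1 + K * X) := by
    have : (1 - K * X) * (1 + K * X) ≤ (1 - X) ^ K * (1 + K * X) := by gcongr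
    linarith
  have hF0 : 0 ≤ (1 - X) ^ K * (X ^ 2 * R X) := by positivity
  have hF1 : (1 - X) ^ K * (X ^ 2 * R X) ≤ X ^ 2 * R (1 / 2) := by
    calc _ ≤ 1 * (X ^ 2 * R (1 / 2)) := by gcongr
      _ = _ := one_mul _
  have hX2 : 0 ≤ (K : ℝ) ^ 2 * X ^ 2 := by positivity
  have hX3 : 0 ≤ X ^ 2 * R (1 / 2) := hF0.trans hF1
  rw [localFactor, hS, abs_le]
  constructor <;> nlinarith

lemma localTerm_succ (r n : ℕ) (p : Nat.Primes) :
    localTerm (r + 1) p n = ((n + r).choose r : ℝ) ^ 2 * ((p : ℝ)⁻¹) ^ n := by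
  rw [localTerm, d_succ_prime_pow _ _ p.2, div_eq_mul_inv, inv_pow]

lemma eulerFactor_succ (r : ℕ) (p : Nat.Primes) :
    eulerFactor (r + 1) p = localFactor r (p : ℝ)⁻¹ := by
  simp only [eulerFactor, localFactor, localSeries, localTerm_succ, one_div]

lemma prime_inv_pos (p : Nat.Primes) : 0 < (p : ℝ)⁻¹ := by
  have := p.2.pos; positivity

lemma prime_inv_le_half (p : Nat.Primes) : (p : ℝ)⁻¹ ≤ 1 / 2 := by
  rw [one_div]
  exact inv_anti₀ (by norm_num) (by exact_mod_cast p.2.two_le)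

lemma summable_localTerm (r : ℕ) (p : Nat.Primes) :
    Summable (fun n : ℕ => localTerm (r + 1) p n) := by
  simp only [localTerm_succ]
  exact summable_localSeries r (prime_inv_pos p) (by linarith [prime_inv_le_half p])

lemma summable_prime_inv_sq : Summable fun p : Nat.Primes => ((p : ℝ)⁻¹) ^ 2 := by
  have h : Summable fun n : ℕ => ((n : ℝ) ^ 2)⁻¹ := Real.summable_nat_pow_inv.2 (by norm_num)
  refine (h.comp_injective Nat.Primes.coe_nat_injective).congr fun p => ?_
  simp

lemma summable_eulerFactor_sub_one (r : ℕ) :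
    Summable fun p : Nat.Primes => eulerFactor (r + 1) p - 1 := by
  obtain ⟨C, hC⟩ := exists_abs_localFactor_sub_one_le r
  refine .of_norm_bounded (summable_prime_inv_sq.mul_left C) fun p => ?_
  rw [eulerFactor_succ]
  exact hC _ (prime_inv_pos p) (prime_inv_le_half p)

lemma multipliable_eulerFactor (r : ℕ) :
    Multipliable fun p : Nat.Primes => eulerFactor (r + 1) p := by
  simpa using Real.multipliable_one_add_of_summable (summable_eulerFactor_sub_one r)

lemma a_succ_pos (r : ℕ) : 0 < a (r + 1) := by
  unfold a
  rw [← Real.rexp_tsum_eq_tprod]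
  · exact Real.exp_pos _
  · intro p
    rw [eulerFactor_succ]
    exact localFactor_pos r (prime_inv_pos p) (by linarith [prime_inv_le_half p])
  · simpa using Real.summable_log_one_add_of_summable (summable_eulerFactor_sub_one r)

lemma prime_rpow_neg_le {s : ℝ} (hs : 0 ≤ s) (p : Nat.Primes) :
    (p : ℝ) ^ (-(1 + s)) ≤ (p : ℝ)⁻¹ := by
  rw [← Real.rpow_neg_one]
  exact Real.rpow_le_rpow_of_exponent_le (by exact_mod_cast p.2.one_le) (by linarith)

lemma prime_rpow_pos (t : ℝ) (p : Nat.Primes) : 0 < (p : ℝ) ^ t :=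
  Real.rpow_pos_of_pos (by exact_mod_cast p.2.pos) _

lemma summable_localFactor_sub_one (r : ℕ) {s : ℝ} (hs : 0 ≤ s) :
    Summable fun p : Nat.Primes => localFactor r ((p : ℝ) ^ (-(1 + s))) - 1 := by
  obtain ⟨C, hC⟩ := exists_abs_localFactor_sub_one_le r
  have hC0 : 0 ≤ C := by
    have := (abs_nonneg _).trans (hC (1 / 2) (by norm_num) le_rfl); linarith
  refine .of_norm_bounded (summable_prime_inv_sq.mul_left C) fun p => ?_
  refine (hC _ (prime_rpow_pos _ p) ((prime_rpow_neg_le hs p).trans (prime_inv_le_half p))).trans ?_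
  have := prime_rpow_pos (-(1 + s)) p
  gcongr
  exact prime_rpow_neg_le hs p

lemma tendsto_localFactor (r : ℕ) (p : Nat.Primes) :
    Tendsto (fun s : ℝ => localFactor r ((p : ℝ) ^ (-(1 + s)))) (𝓝[>] 0)
      (𝓝 (localFactor r (p : ℝ)⁻¹)) := by
  have hp : (0 : ℝ) < p := by exact_mod_cast p.2.pos
  have hX : Tendsto (fun s : ℝ => (p : ℝ) ^ (-(1 + s))) (𝓝[>] 0) (𝓝 (p : ℝ)⁻¹) := by
    have : Continuous fun s : ℝ => (p : ℝ) ^ (-(1 + s)) :=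
      Continuous.rpow continuous_const (by fun_prop) (fun _ => Or.inl hp.ne')
    have h := this.tendsto 0
    simp only [add_zero, Real.rpow_neg_one] at h
    exact h.mono_left nhdsWithin_le_nhds
  refine ((tendsto_const_nhds.sub hX).pow _).mul ?_
  refine tendsto_tsum_of_dominated_convergence
    (summable_localSeries r (prime_inv_pos p) (by linarith [prime_inv_le_half p]))
    (fun n => (hX.pow n).const_mul _) ?_
  filter_upwards [self_mem_nhdsWithin] with s hs n
  have h0 := prime_rpow_pos (-(1 + s)) p
  rw [Real.norm_of_nonneg (by positivity)]
  gcongr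
  exact prime_rpow_neg_le (le_of_lt hs) p

/-- Dominated convergence for products: `C * p⁻²` bounds the deviation from `1` for every `s > 0` at
once. -/
lemma tendsto_tprod_localFactor (r : ℕ) :
    Tendsto (fun s : ℝ => ∏' p : Nat.Primes, localFactor r ((p : ℝ) ^ (-(1 + s)))) (𝓝[>] 0)
      (𝓝 (a (r + 1))) := by
  obtain ⟨C, hC⟩ := exists_abs_localFactor_sub_one_le r
  have hC0 : 0 ≤ C := by
    have := (abs_nonneg _).trans (hC (1 / 2) (by norm_num) le_rfl); linarith
  have h := tendsto_tprod_one_add_of_dominated_convergence (𝓕 := 𝓝[>] (0 : ℝ))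
    (f := fun (s : ℝ) (p : Nat.Primes) => localFactor r ((p : ℝ) ^ (-(1 + s))) - 1)
    (g := fun p : Nat.Primes => localFactor r (p : ℝ)⁻¹ - 1)
    (summable_prime_inv_sq.mul_left C)
    (fun p => (tendsto_localFactor r p).sub_const 1) ?_
  · simp only [add_sub_cancel] at h
    unfold a
    simpa only [eulerFactor_succ] using h
  · filter_upwards [self_mem_nhdsWithin] with s hs p
    have hs' : 0 ≤ s := le_of_lt hs
    refine (hC _ (prime_rpow_pos _ p)
      ((prime_rpow_neg_le hs' p).trans (prime_inv_le_half p))).trans ?_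
    have := prime_rpow_pos (-(1 + s)) p
    gcongr
    exact prime_rpow_neg_le hs' p

/-! ### Euler products and the pole at `1`. -/

lemma hasProd_zeta {s : ℝ} (hs : 0 < s) :
    HasProd (fun p : Nat.Primes => (1 - (p : ℝ) ^ (-(1 + s)))⁻¹)
      (∑' n : ℕ, 1 / (n : ℝ) ^ (1 + s)) := by
  let f : ℕ →*₀ ℝ :=
    { toFun := fun n => (n : ℝ) ^ (-(1 + s))
      map_zero' := by
        simp only [Nat.cast_zero]
        exact Real.zero_rpow (by linarith)
      map_one' := by simp
      map_mul' := fun m n => by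
        push_cast; exact Real.mul_rpow (by positivity) (by positivity) }
  have hf (n : ℕ) : f n = 1 / (n : ℝ) ^ (1 + s) := by
    change (n : ℝ) ^ (-(1 + s)) = _
    rw [Real.rpow_neg (by positivity), one_div]
  have hsum : Summable (‖f ·‖) := by
    refine (Real.summable_one_div_nat_rpow.2 (by linarith : 1 < 1 + s)).congr fun n => ?_
    rw [hf, Real.norm_of_nonneg (by positivity)]
  have h := EulerProduct.eulerProduct_completely_multiplicative_hasProd hsum
  simp only [hf] at h
  have hp (p : Nat.Primes) : (p : ℝ) ^ (-(1 + s)) = 1 / (p : ℝ) ^ (1 + s) := by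
    rw [← hf]; rfl
  simp only [hp]
  exact h

lemma hasProd_d_sq (r : ℕ) {s : ℝ} (hs : 0 < s) :
    HasProd (fun p : Nat.Primes => localSeries r ((p : ℝ) ^ (-(1 + s))))
      (∑' n : ℕ, (d (r + 1) n : ℝ) ^ 2 / (n : ℝ) ^ (1 + s)) := by
  have h := EulerProduct.eulerProduct_hasProd
    (f := fun n : ℕ => (d (r + 1) n : ℝ) ^ 2 / (n : ℝ) ^ (1 + s))
    (by simp [d_apply_one]) (fun {m n} hmn => ?_)
    ((summable_d_sq_div_rpow (r + 1) (by linarith : 1 < 1 + s)).norm) (by simp [d_apply_zero])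
  · have hloc (p : Nat.Primes) : localSeries r ((p : ℝ) ^ (-(1 + s))) =
        ∑' n : ℕ, (d (r + 1) ((p : ℕ) ^ n) : ℝ) ^ 2 / (((p : ℕ) ^ n : ℕ) : ℝ) ^ (1 + s) := by
      rw [localSeries]
      refine tsum_congr fun n => ?_
      have hp : (0 : ℝ) ≤ p := by positivity
      rw [d_succ_prime_pow _ _ p.2, Nat.cast_pow, ← Real.rpow_natCast (p : ℝ) n,
        ← Real.rpow_mul hp, ← Real.rpow_natCast ((p : ℝ) ^ (-(1 + s))) n, ← Real.rpow_mul hp,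
        div_eq_mul_inv, ← Real.rpow_neg hp]
      congr 2
      ring
    simp only [hloc]
    exact h
  · rw [d_mul_of_coprime _ hmn]
    push_cast
    rw [Real.mul_rpow (by positivity) (by positivity)]
    ring

lemma tsum_d_sq_eq (r : ℕ) {s : ℝ} (hs : 0 < s) :
    ∑' n : ℕ, (d (r + 1) n : ℝ) ^ 2 / (n : ℝ) ^ (1 + s) =
      (∑' n : ℕ, 1 / (n : ℝ) ^ (1 + s)) ^ ((r + 1) ^ 2) *
        ∏' p : Nat.Primes, localFactor r ((p : ℝ) ^ (-(1 + s))) := by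
  have hm : Multipliable fun p : Nat.Primes => localFactor r ((p : ℝ) ^ (-(1 + s))) := by
    simpa using Real.multipliable_one_add_of_summable (summable_localFactor_sub_one r hs.le)
  have hz := hasProd_zeta hs
  rw [← (hasProd_d_sq r hs).tprod_eq, ← hz.tprod_eq, ← hz.multipliable.tprod_pow,
    ← (hz.multipliable.pow _).tprod_mul hm]
  refine tprod_congr fun p => ?_
  have h1 : (p : ℝ) ^ (-(1 + s)) < 1 := by
    linarith [prime_rpow_neg_le hs.le p, prime_inv_le_half p]
  have h2 : 1 - (p : ℝ) ^ (-(1 + s)) ≠ 0 := by linarith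
  rw [localFactor, ← mul_assoc, ← mul_pow, inv_mul_cancel₀ h2, one_pow, one_mul]

/-- The Dirichlet series of `d_{r+1}(n)²` has a pole of order `(r + 1)²` at `1` with leading
coefficient `a_{r+1}`. -/
theorem tendsto_pow_mul_tsum_d_sq (r : ℕ) :
    Tendsto (fun s : ℝ => s ^ ((r + 1) ^ 2) *
      ∑' n : ℕ, (d (r + 1) n : ℝ) ^ 2 / (n : ℝ) ^ (1 + s)) (𝓝[>] 0) (𝓝 (a (r + 1))) := by
  have h1 : Tendsto (fun s : ℝ => 1 + s) (𝓝[>] 0) (𝓝[>] 1) := by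
    refine tendsto_nhdsWithin_iff.2 ⟨?_, ?_⟩
    · have : Continuous fun s : ℝ => 1 + s := by fun_prop
      simpa using (this.tendsto 0).mono_left nhdsWithin_le_nhds
    · filter_upwards [self_mem_nhdsWithin] with s hs
      simpa using hs
  have h2 := ((tendsto_sub_mul_tsum_nat_rpow.comp h1).pow ((r + 1) ^ 2)).mul
    (tendsto_tprod_localFactor r)
  rw [one_pow, one_mul] at h2
  refine h2.congr' ?_
  filter_upwards [self_mem_nhdsWithin] with s hs
  simp only [Function.comp, add_sub_cancel_left]
  rw [tsum_d_sq_eq r hs, mul_pow, mul_assoc]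

end LargeGaps

/-! ### Karamata's Tauberian theorem. -/

namespace LargeGaps

open Filter Topology MeasureTheory Set

/-- The average of `h (exp (-u))` against the Gamma distribution of shape `K`. -/
noncomputable def gammaAverage (K : ℕ) (h : ℝ → ℝ) : ℝ :=
  (Real.Gamma K)⁻¹ * ∫ u in Ioi (0 : ℝ), u ^ (K - 1) * Real.exp (-u) * h (Real.exp (-u))

/-- The normalized sum `s ^ K * ∑ cₙ exp (-s lₙ) h (exp (-s lₙ))`. -/
noncomputable def laplaceAverage (K : ℕ) (c l : ℕ → ℝ) (h : ℝ → ℝ) (s : ℝ) : ℝ :=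
  s ^ K * ∑' n, c n * Real.exp (-(s * l n)) * h (Real.exp (-(s * l n)))

lemma exp_neg_mem_Icc {u : ℝ} (hu : 0 ≤ u) : Real.exp (-u) ∈ Icc (0 : ℝ) 1 :=
  ⟨(Real.exp_pos _).le, Real.exp_le_one_iff.2 (by linarith)⟩

lemma integrableOn_gamma {K : ℕ} (hK : 0 < K) :
    IntegrableOn (fun u : ℝ => u ^ (K - 1) * Real.exp (-u)) (Ioi 0) := by
  refine (Real.GammaIntegral_convergent (s := K) (by exact_mod_cast hK)).congr_fun
    (fun u hu => ?_) measurableSet_Ioi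
  simp only
  rw [mul_comm, ← Nat.cast_one, ← Nat.cast_sub hK, Real.rpow_natCast]

lemma integrableOn_gamma_mul {K : ℕ} (hK : 0 < K) {h : ℝ → ℝ} (hm : Measurable h) {B : ℝ}
    (hB : ∀ x ∈ Icc (0 : ℝ) 1, |h x| ≤ B) :
    IntegrableOn (fun u : ℝ => u ^ (K - 1) * Real.exp (-u) * h (Real.exp (-u))) (Ioi 0) := by
  refine (integrableOn_gamma hK).mul_bdd (c := B)
    (hm.comp (by fun_prop)).aestronglyMeasurable ?_
  filter_upwards [ae_restrict_mem measurableSet_Ioi] with u hu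
  exact hB _ (exp_neg_mem_Icc (le_of_lt hu))

lemma gammaAverage_pow {K : ℕ} (hK : 0 < K) (m : ℕ) :
    gammaAverage K (fun x => x ^ m) = (((m : ℝ) + 1) ^ K)⁻¹ := by
  have hG : 0 < Real.Gamma K := Real.Gamma_pos_of_pos (by exact_mod_cast hK)
  have h := Real.integral_rpow_mul_exp_neg_mul_Ioi (a := K) (r := (m : ℝ) + 1)
    (by exact_mod_cast hK) (by positivity)
  have h2 : ∫ u in Ioi (0 : ℝ), u ^ (K - 1) * Real.exp (-u) * Real.exp (-u) ^ m =
      ∫ u in Ioi (0 : ℝ), u ^ ((K : ℝ) - 1) * Real.exp (-(((m : ℝ) + 1) * u)) := by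
    refine setIntegral_congr_fun measurableSet_Ioi fun u hu => ?_
    have hK1 : (K : ℝ) - 1 = ((K - 1 : ℕ) : ℝ) := by rw [Nat.cast_sub hK, Nat.cast_one]
    rw [hK1, Real.rpow_natCast, ← Real.exp_nat_mul, mul_assoc,
      ← Real.exp_add]
    congr 2
    ring
  rw [gammaAverage, h2, h, Real.rpow_natCast, one_div, inv_pow]
  field_simp

/-- The Gamma density has total mass `1`, the case `m = 0` of `gammaAverage_pow`. -/
lemma abs_gammaAverage_sub_le {K : ℕ} (hK : 0 < K) {g h : ℝ → ℝ} (hg : Measurable g)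
    (hh : Measurable h) {B ε : ℝ} (hgB : ∀ x ∈ Icc (0 : ℝ) 1, |g x| ≤ B)
    (hhB : ∀ x ∈ Icc (0 : ℝ) 1, |h x| ≤ B) (hε : ∀ x ∈ Icc (0 : ℝ) 1, |h x - g x| ≤ ε) :
    |gammaAverage K h - gammaAverage K g| ≤ ε := by
  have hG : 0 < Real.Gamma K := Real.Gamma_pos_of_pos (by exact_mod_cast hK)
  have h1 : gammaAverage K (fun x => x ^ 0) = 1 := by
    rw [gammaAverage_pow hK]; simp
  unfold gammaAverage at h1 ⊢
  rw [← mul_sub, ← integral_sub (integrableOn_gamma_mul hK hh hhB)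
    (integrableOn_gamma_mul hK hg hgB), abs_mul, abs_of_pos (inv_pos.2 hG), ← mul_one ε, ← h1,
    mul_left_comm ε]
  refine mul_le_mul_of_nonneg_left ?_ (inv_pos.2 hG).le
  rw [← integral_const_mul]
  rw [← Real.norm_eq_abs]
  refine norm_integral_le_of_norm_le ?_ ?_
  · simpa using (integrableOn_gamma hK).const_mul ε
  · filter_upwards [ae_restrict_mem measurableSet_Ioi] with u hu
    have hu' : 0 < u := hu
    have h2 := hε _ (exp_neg_mem_Icc hu'.le)
    rw [← mul_sub, norm_mul, Real.norm_of_nonneg (by positivity), Real.norm_eq_abs, pow_zero,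
      mul_one, mul_comm ε]
    gcongr

section Laplace

variable {K : ℕ} {c l : ℕ → ℝ}

lemma summable_laplace (hc : ∀ n, 0 ≤ c n) (hl : ∀ n, 0 ≤ l n)
    (hs : ∀ s : ℝ, 0 < s → Summable fun n => c n * Real.exp (-(s * l n)))
    {s : ℝ} (hs0 : 0 < s) {h : ℝ → ℝ} {B : ℝ} (hB : ∀ x ∈ Icc (0 : ℝ) 1, |h x| ≤ B) :
    Summable fun n => c n * Real.exp (-(s * l n)) * h (Real.exp (-(s * l n))) := by
  refine .of_norm_bounded ((hs s hs0).mul_right B) fun n => ?_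
  have := hc n
  rw [norm_mul, Real.norm_of_nonneg (by positivity)]
  gcongr
  exact hB _ (exp_neg_mem_Icc (mul_nonneg hs0.le (hl n)))

lemma laplaceAverage_mono (hc : ∀ n, 0 ≤ c n) (hl : ∀ n, 0 ≤ l n)
    (hs : ∀ s : ℝ, 0 < s → Summable fun n => c n * Real.exp (-(s * l n)))
    {s : ℝ} (hs0 : 0 < s) {g h : ℝ → ℝ} {B C : ℝ} (hgB : ∀ x ∈ Icc (0 : ℝ) 1, |g x| ≤ B)
    (hhB : ∀ x ∈ Icc (0 : ℝ) 1, |h x| ≤ C) (hgh : ∀ x ∈ Icc (0 : ℝ) 1, g x ≤ h x) :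
    laplaceAverage K c l g s ≤ laplaceAverage K c l h s := by
  refine mul_le_mul_of_nonneg_left ?_ (by positivity)
  refine (summable_laplace hc hl hs hs0 hgB).tsum_le_tsum (fun n => ?_)
    (summable_laplace hc hl hs hs0 hhB)
  have := hc n
  have := hgh _ (exp_neg_mem_Icc (mul_nonneg hs0.le (hl n)))
  gcongr

lemma laplaceAverage_add (hc : ∀ n, 0 ≤ c n) (hl : ∀ n, 0 ≤ l n)
    (hs : ∀ s : ℝ, 0 < s → Summable fun n => c n * Real.exp (-(s * l n)))
    {s : ℝ} (hs0 : 0 < s) {g h : ℝ → ℝ} {B C : ℝ} (hgB : ∀ x ∈ Icc (0 : ℝ) 1, |g x| ≤ B)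
    (hhB : ∀ x ∈ Icc (0 : ℝ) 1, |h x| ≤ C) :
    laplaceAverage K c l (fun x => g x + h x) s =
      laplaceAverage K c l g s + laplaceAverage K c l h s := by
  unfold laplaceAverage
  rw [← mul_add, ← (summable_laplace hc hl hs hs0 hgB).tsum_add
    (summable_laplace hc hl hs hs0 hhB)]
  simp only [mul_add]

lemma laplaceAverage_const_mul (a : ℝ) (h : ℝ → ℝ) (s : ℝ) :
    laplaceAverage K c l (fun x => a * h x) s = a * laplaceAverage K c l h s := by
  unfold laplaceAverage
  rw [mul_left_comm, ← tsum_mul_left (a := a)]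
  simp only [mul_left_comm a]

lemma gammaAverage_const_mul (a : ℝ) (h : ℝ → ℝ) :
    gammaAverage K (fun x => a * h x) = a * gammaAverage K h := by
  unfold gammaAverage
  rw [mul_left_comm, ← integral_const_mul a]
  simp only [mul_left_comm a]

lemma gammaAverage_add (hK : 0 < K) {g h : ℝ → ℝ} (hg : Measurable g)
    (hh : Measurable h) {B C : ℝ} (hgB : ∀ x ∈ Icc (0 : ℝ) 1, |g x| ≤ B)
    (hhB : ∀ x ∈ Icc (0 : ℝ) 1, |h x| ≤ C) :
    gammaAverage K (fun x => g x + h x) = gammaAverage K g + gammaAverage K h := by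
  unfold gammaAverage
  rw [← mul_add, ← integral_add (integrableOn_gamma_mul hK hg hgB)
    (integrableOn_gamma_mul hK hh hhB)]
  simp only [mul_add]

lemma exists_abs_le_of_continuous {h : ℝ → ℝ} (hh : Continuous h) :
    ∃ B, ∀ x ∈ Icc (0 : ℝ) 1, |h x| ≤ B :=
  isCompact_Icc.exists_bound_of_continuousOn hh.continuousOn

/-- Inserting the `m`-th power replaces `s` by `(m + 1) * s` in the exponential; rescaling `s ^ K`
produces the factor `(m + 1) ^ (-K)`, which is the Gamma average of `x ^ m`. -/
lemma tendsto_laplaceAverage_pow (hK : 0 < K) {A : ℝ}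
    (hA : Tendsto (fun s : ℝ => s ^ K * ∑' n, c n * Real.exp (-(s * l n))) (𝓝[>] 0) (𝓝 A))
    (m : ℕ) :
    Tendsto (laplaceAverage K c l (fun x => x ^ m)) (𝓝[>] 0)
      (𝓝 (A * gammaAverage K (fun x => x ^ m))) := by
  have hm : (0 : ℝ) < (m : ℝ) + 1 := by positivity
  have h1 : Tendsto (fun s : ℝ => ((m : ℝ) + 1) * s) (𝓝[>] 0) (𝓝[>] 0) := by
    refine tendsto_nhdsWithin_iff.2 ⟨?_, ?_⟩
    · have : Continuous fun s : ℝ => ((m : ℝ) + 1) * s := by fun_prop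
      simpa using (this.tendsto 0).mono_left nhdsWithin_le_nhds
    · filter_upwards [self_mem_nhdsWithin] with s hs
      exact mul_pos hm hs
  rw [gammaAverage_pow hK]
  refine ((hA.comp h1).mul_const _).congr fun s => ?_
  simp only [Function.comp, laplaceAverage]
  have h2 (n : ℕ) : c n * Real.exp (-(s * l n)) * Real.exp (-(s * l n)) ^ m =
      c n * Real.exp (-(((m : ℝ) + 1) * s * l n)) := by
    rw [← Real.exp_nat_mul, mul_assoc, ← Real.exp_add]
    congr 2
    ring
  simp only [h2]
  rw [mul_pow]
  field_simp

lemma tendsto_laplaceAverage_polynomial (hK : 0 < K) (hc : ∀ n, 0 ≤ c n) (hl : ∀ n, 0 ≤ l n)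
    (hs : ∀ s : ℝ, 0 < s → Summable fun n => c n * Real.exp (-(s * l n))) {A : ℝ}
    (hA : Tendsto (fun s : ℝ => s ^ K * ∑' n, c n * Real.exp (-(s * l n))) (𝓝[>] 0) (𝓝 A))
    (p : Polynomial ℝ) :
    Tendsto (laplaceAverage K c l (fun x => p.eval x)) (𝓝[>] 0)
      (𝓝 (A * gammaAverage K (fun x => p.eval x))) := by
  induction p using Polynomial.induction_on' with
  | add p q hp hq =>
    obtain ⟨B, hB⟩ := exists_abs_le_of_continuous p.continuous
    obtain ⟨C, hC⟩ := exists_abs_le_of_continuous q.continuous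
    simp only [Polynomial.eval_add]
    rw [gammaAverage_add hK p.continuous.measurable q.continuous.measurable hB hC, mul_add]
    refine (hp.add hq).congr' ?_
    filter_upwards [self_mem_nhdsWithin] with s hs0
    exact (laplaceAverage_add hc hl hs hs0 hB hC).symm
  | monomial m a =>
    simp only [Polynomial.eval_monomial]
    rw [gammaAverage_const_mul, mul_left_comm]
    refine ((tendsto_laplaceAverage_pow hK hA m).const_mul a).congr fun s => ?_
    rw [laplaceAverage_const_mul]

/-- Weierstrass approximation: since `c` is nonnegative, a uniform error `δ` costs at most `δ` times
the average of `1`, which stays bounded. -/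
lemma tendsto_laplaceAverage_continuous (hK : 0 < K) (hc : ∀ n, 0 ≤ c n) (hl : ∀ n, 0 ≤ l n)
    (hs : ∀ s : ℝ, 0 < s → Summable fun n => c n * Real.exp (-(s * l n))) {A : ℝ}
    (hA : Tendsto (fun s : ℝ => s ^ K * ∑' n, c n * Real.exp (-(s * l n))) (𝓝[>] 0) (𝓝 A))
    {h : ℝ → ℝ} (hh : Continuous h) :
    Tendsto (laplaceAverage K c l h) (𝓝[>] 0) (𝓝 (A * gammaAverage K h)) := by
  have hA0 : 0 ≤ A := by
    refine ge_of_tendsto hA ?_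
    filter_upwards [self_mem_nhdsWithin] with s hs0
    have hs0' : 0 < s := hs0
    exact mul_nonneg (by positivity)
      (tsum_nonneg fun n => mul_nonneg (hc n) (Real.exp_pos _).le)
  rw [Metric.tendsto_nhds]
  intro ε hε
  -- The errors are `(A + 1) * δ` for the sum, `δ` for the polynomial limit and `A * δ` for the
  -- Gamma average.
  set δ : ℝ := ε / (2 * A + 3) with hδ
  have hδ0 : 0 < δ := by positivity
  obtain ⟨p, hp⟩ := exists_polynomial_near_of_continuousOn 0 1 h hh.continuousOn δ hδ0
  obtain ⟨B, hB⟩ := exists_abs_le_of_continuous hh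
  obtain ⟨C, hC⟩ := exists_abs_le_of_continuous p.continuous
  have hp' : ∀ x ∈ Icc (0 : ℝ) 1, |h x - p.eval x| ≤ δ := fun x hx => by
    rw [abs_sub_comm]; exact (hp x hx).le
  have hg : |gammaAverage K h - gammaAverage K (fun x => p.eval x)| ≤ δ :=
    abs_gammaAverage_sub_le hK p.continuous.measurable hh.measurable (B := max B C)
      (fun x hx => (hC x hx).trans (le_max_right _ _))
      (fun x hx => (hB x hx).trans (le_max_left _ _)) hp'
  have hg' : |A * gammaAverage K h - A * gammaAverage K (fun x => p.eval x)| ≤ A * δ := by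
    rw [← mul_sub, abs_mul, abs_of_nonneg hA0]
    gcongr
  have hev := Metric.tendsto_nhds.1
    (tendsto_laplaceAverage_polynomial hK hc hl hs hA p) δ hδ0
  have hev1 := hA.eventually (gt_mem_nhds (lt_add_one A))
  filter_upwards [hev, hev1, self_mem_nhdsWithin] with s h1 h2 hs0
  have hs0' : 0 < s := hs0
  have hone : laplaceAverage K c l (fun _ => δ) s ≤ (A + 1) * δ := by
    unfold laplaceAverage
    rw [tsum_mul_right, ← mul_assoc]
    gcongr
  have hbd : ∀ x ∈ Icc (0 : ℝ) 1, |(fun _ : ℝ => δ) x| ≤ δ := fun x _ => (abs_of_pos hδ0).le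
  have hsum (g k : ℝ → ℝ) (B' : ℝ) (C' : ℝ) (hgB : ∀ x ∈ Icc (0 : ℝ) 1, |g x| ≤ B')
      (hkC : ∀ x ∈ Icc (0 : ℝ) 1, |k x| ≤ C')
      (hgk : ∀ x ∈ Icc (0 : ℝ) 1, |g x - k x| ≤ δ) :
      laplaceAverage K c l g s ≤ laplaceAverage K c l k s + (A + 1) * δ := by
    calc _ ≤ laplaceAverage K c l (fun x => k x + δ) s := by
          refine laplaceAverage_mono hc hl hs hs0' (C := C' + δ) hgB (fun x hx => ?_)
            fun x hx => ?_
          · refine (abs_add_le _ _).trans (add_le_add (hkC x hx) (abs_of_pos hδ0).le)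
          · linarith [(abs_le.1 (hgk x hx)).2]
      _ = _ := laplaceAverage_add hc hl hs hs0' hkC hbd
      _ ≤ _ := by gcongr
  have h3 := hsum _ _ B C hB hC hp'
  have h4 := hsum _ _ C B hC hB fun x hx => (hp x hx).le
  rw [Real.dist_eq, abs_lt] at h1
  rw [abs_le] at hg'
  have hδε : (2 * A + 3) * δ = ε := by rw [hδ]; field_simp
  rw [Real.dist_eq, abs_lt]
  constructor <;> linarith

lemma tendsto_laplaceAverage_of_sandwich (hK : 0 < K) (hc : ∀ n, 0 ≤ c n)
    (hl : ∀ n, 0 ≤ l n)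
    (hs : ∀ s : ℝ, 0 < s → Summable fun n => c n * Real.exp (-(s * l n))) {A : ℝ}
    (hA : Tendsto (fun s : ℝ => s ^ K * ∑' n, c n * Real.exp (-(s * l n))) (𝓝[>] 0) (𝓝 A))
    {f : ℝ → ℝ} {B : ℝ} (hf : ∀ x ∈ Icc (0 : ℝ) 1, |f x| ≤ B) {g k : ℕ → ℝ → ℝ}
    (hg : ∀ m, Continuous (g m)) (hk : ∀ m, Continuous (k m))
    (hgf : ∀ m, ∀ x ∈ Icc (0 : ℝ) 1, g m x ≤ f x) (hfk : ∀ m, ∀ x ∈ Icc (0 : ℝ) 1, f x ≤ k m x)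
    (hgt : Tendsto (fun m => gammaAverage K (g m)) atTop (𝓝 (gammaAverage K f)))
    (hkt : Tendsto (fun m => gammaAverage K (k m)) atTop (𝓝 (gammaAverage K f))) :
    Tendsto (laplaceAverage K c l f) (𝓝[>] 0) (𝓝 (A * gammaAverage K f)) := by
  refine tendsto_order.2 ⟨fun b hb => ?_, fun b hb => ?_⟩
  · obtain ⟨m, hm⟩ := ((hgt.const_mul A).eventually (lt_mem_nhds hb)).exists
    obtain ⟨C, hC⟩ := exists_abs_le_of_continuous (hg m)
    filter_upwards [(tendsto_laplaceAverage_continuous hK hc hl hs hA (hg m)).eventually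
      (lt_mem_nhds hm), self_mem_nhdsWithin] with s h1 h2
    exact h1.trans_le (laplaceAverage_mono hc hl hs h2 hC hf (hgf m))
  · obtain ⟨m, hm⟩ := ((hkt.const_mul A).eventually (gt_mem_nhds hb)).exists
    obtain ⟨C, hC⟩ := exists_abs_le_of_continuous (hk m)
    filter_upwards [(tendsto_laplaceAverage_continuous hK hc hl hs hA (hk m)).eventually
      (gt_mem_nhds hm), self_mem_nhdsWithin] with s h1 h2
    exact (laplaceAverage_mono hc hl hs h2 hf hC (hfk m)).trans_lt h1

lemma tendsto_gammaAverage_of_dominated (hK : 0 < K) {g : ℕ → ℝ → ℝ} {f : ℝ → ℝ} {B : ℝ}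
    (hg : ∀ m, Measurable (g m)) (hB : ∀ m, ∀ x ∈ Icc (0 : ℝ) 1, |g m x| ≤ B) (x₀ : ℝ)
    (hlim : ∀ x, x ≠ x₀ → Tendsto (fun m => g m x) atTop (𝓝 (f x))) :
    Tendsto (fun m => gammaAverage K (g m)) atTop (𝓝 (gammaAverage K f)) := by
  refine Tendsto.const_mul _ ?_
  refine tendsto_integral_of_dominated_convergence
    (fun u => u ^ (K - 1) * Real.exp (-u) * B) (fun m => ?_)
    ((integrableOn_gamma hK).mul_const B) (fun m => ?_) ?_
  · have := hg m
    exact Measurable.aestronglyMeasurable (by fun_prop)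
  · filter_upwards [ae_restrict_mem measurableSet_Ioi] with u hu
    have hu' : 0 < u := hu
    rw [norm_mul, Real.norm_of_nonneg (by positivity)]
    gcongr
    exact hB m _ (exp_neg_mem_Icc hu'.le)
  -- The exceptional point `x₀` is met only at `u = -log x₀`, a null set.
  · have h0 : ∀ᵐ u : ℝ ∂(volume.restrict (Ioi 0)), u ≠ -Real.log x₀ :=
      (measure_eq_zero_iff_ae_notMem.1
        (show (volume.restrict (Ioi 0)) {-Real.log x₀} = 0 by simp)).mono fun u hu => by
        simpa using hu
    filter_upwards [h0] with u hu
    refine Tendsto.const_mul _ (hlim _ fun h => hu ?_)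
    rw [← h, Real.log_exp, neg_neg]

/-- Karamata's Tauberian theorem with a continuous nonnegative weight on the truncated sum. -/
theorem tendsto_tsum_truncated (hK : 0 < K) (hc : ∀ n, 0 ≤ c n) (hl : ∀ n, 0 ≤ l n)
    (hs : ∀ s : ℝ, 0 < s → Summable fun n => c n * Real.exp (-(s * l n))) {A : ℝ}
    (hA : Tendsto (fun s : ℝ => s ^ K * ∑' n, c n * Real.exp (-(s * l n))) (𝓝[>] 0) (𝓝 A))
    {ψ : ℝ → ℝ} (hψ : Continuous ψ) (hψ0 : ∀ x, 0 ≤ ψ x) :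
    Tendsto (fun s : ℝ => s ^ K * ∑' n, if s * l n ≤ 1 then c n * ψ (s * l n) else 0) (𝓝[>] 0)
      (𝓝 (A * ((Real.Gamma K)⁻¹ * ∫ u in (0 : ℝ)..1, u ^ (K - 1) * ψ u))) := by
  set e : ℝ := Real.exp (-1) with he
  have he0 : 0 < e := Real.exp_pos _
  -- Chosen so that `exp (-u) * φ (exp (-u)) = ψ u` for `u ≤ 1`; the `max` keeps `φ` continuous on
  -- the whole line. The truncation `u ≤ 1` becomes the jump of `f` at `e`.
  set φ : ℝ → ℝ := fun x => ψ (-Real.log (max x e)) / max x e with hφ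
  have hmax (x : ℝ) : 0 < max x e := lt_max_of_lt_right he0
  have hφc : Continuous φ := by
    have h1 : Continuous fun x : ℝ => max x e := by fun_prop
    exact (hψ.comp (h1.log fun x => (hmax x).ne').neg).div h1 fun x => (hmax x).ne'
  have hφ0 (x : ℝ) : 0 ≤ φ x := div_nonneg (hψ0 _) (hmax x).le
  have hexp (u : ℝ) : e ≤ Real.exp (-u) ↔ u ≤ 1 := by
    rw [he, Real.exp_le_exp]; constructor <;> intro h <;> linarith
  have hval (u : ℝ) (hu : u ≤ 1) : Real.exp (-u) * φ (Real.exp (-u)) = ψ u := by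
    simp only [hφ]
    rw [max_eq_left ((hexp u).2 hu), Real.log_exp, neg_neg]
    have := Real.exp_pos (-u)
    field_simp
  set f : ℝ → ℝ := fun x => if e ≤ x then φ x else 0 with hf
  obtain ⟨B, hB⟩ := exists_abs_le_of_continuous hφc
  -- Ramps of slope `m`, rising just after `e` for `ρ` and just before it for `ρ'`. As `φ` is
  -- nonnegative, `φ * ρ m ≤ f ≤ φ * ρ' m`.
  set ρ : ℕ → ℝ → ℝ := fun m x => max 0 (min 1 (m * (x - e))) with hρ
  set ρ' : ℕ → ℝ → ℝ := fun m x => max 0 (min 1 (1 + m * (x - e))) with hρ'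
  have hbd (t : ℝ) : |max 0 (min 1 t)| ≤ 1 := by
    rw [abs_of_nonneg (le_max_left _ _)]; simp
  have hB0 : 0 ≤ B := (abs_nonneg _).trans (hB 0 (by simp))
  have hmulB (t x : ℝ) (hx : x ∈ Icc (0 : ℝ) 1) : |φ x * max 0 (min 1 t)| ≤ B := by
    rw [abs_mul]
    calc _ ≤ B * 1 := mul_le_mul (hB x hx) (hbd t) (abs_nonneg _) hB0
      _ = B := mul_one B
  have hfB : ∀ x ∈ Icc (0 : ℝ) 1, |f x| ≤ B := fun x hx => by
    simp only [hf]
    split_ifs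
    · exact hB x hx
    · simpa using hB0
  have hρc (m : ℕ) : Continuous fun x => φ x * ρ m x := by
    simp only [hρ]; fun_prop
  have hρc' (m : ℕ) : Continuous fun x => φ x * ρ' m x := by
    simp only [hρ']; fun_prop
  have hbig (x : ℝ) (hx : 0 < x) (b : ℝ) : ∀ᶠ m : ℕ in atTop, b ≤ m * x :=
    (tendsto_natCast_atTop_atTop.atTop_mul_const hx).eventually_ge_atTop b
  have hlim : ∀ x, x ≠ e → Tendsto (fun m => φ x * ρ m x) atTop (𝓝 (f x)) := fun x hx => by
    rcases lt_or_gt_of_ne hx with h | h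
    · refine tendsto_const_nhds.congr fun m => ?_
      have : (m : ℝ) * (x - e) ≤ 0 := mul_nonpos_of_nonneg_of_nonpos (by positivity) (by linarith)
      simp only [hf, hρ]
      rw [if_neg (not_le.2 h), max_eq_left ((min_le_right _ _).trans this), mul_zero]
    · refine tendsto_const_nhds.congr' ?_
      filter_upwards [hbig (x - e) (by linarith) 1] with m hm
      simp only [hf, hρ]
      rw [if_pos h.le, min_eq_left hm, max_eq_right zero_le_one, mul_one]
  have hlim' : ∀ x, x ≠ e → Tendsto (fun m => φ x * ρ' m x) atTop (𝓝 (f x)) := fun x hx => by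
    rcases lt_or_gt_of_ne hx with h | h
    · refine tendsto_const_nhds.congr' ?_
      filter_upwards [hbig (e - x) (by linarith) 1] with m hm
      simp only [hf, hρ']
      rw [if_neg (not_le.2 h), max_eq_left ((min_le_right _ _).trans (by linarith)), mul_zero]
    · refine tendsto_const_nhds.congr fun m => ?_
      have : 0 ≤ (m : ℝ) * (x - e) := mul_nonneg (by positivity) (by linarith)
      simp only [hf, hρ']
      rw [if_pos h.le, min_eq_left (by linarith), max_eq_right zero_le_one, mul_one]
  have key := tendsto_laplaceAverage_of_sandwich hK hc hl hs hA (f := f) hfB hρc hρc'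
    (fun m x hx => ?_) (fun m x hx => ?_)
    (tendsto_gammaAverage_of_dominated hK (fun m => (hρc m).measurable)
      (fun m x hx => hmulB _ x hx) e hlim)
    (tendsto_gammaAverage_of_dominated hK (fun m => (hρc' m).measurable)
      (fun m x hx => hmulB _ x hx) e hlim')
  · have hint : gammaAverage K f =
        (Real.Gamma K)⁻¹ * ∫ u in (0 : ℝ)..1, u ^ (K - 1) * ψ u := by
      rw [gammaAverage]
      congr 1
      rw [intervalIntegral.integral_of_le zero_le_one, ← integral_indicator measurableSet_Ioi,
        ← integral_indicator measurableSet_Ioc]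
      congr 1
      ext u
      simp only [indicator, mem_Ioi, mem_Ioc, hf, hexp]
      by_cases h0 : 0 < u
      · by_cases h1 : u ≤ 1
        · simp only [h0, h1, if_true, and_self]
          rw [mul_assoc, hval u h1]
        · simp [h0, h1]
      · simp [h0]
    rw [← hint]
    refine key.congr fun s => ?_
    unfold laplaceAverage
    congr 1
    refine tsum_congr fun n => ?_
    simp only [hf, hexp]
    split_ifs with h
    · rw [mul_assoc, hval _ h]
    · simp
  · simp only [hf, hρ]
    split_ifs with h
    · calc _ ≤ φ x * 1 := mul_le_mul_of_nonneg_left (by simp) (hφ0 x)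
        _ = _ := mul_one _
    · have : (m : ℝ) * (x - e) ≤ 0 :=
        mul_nonpos_of_nonneg_of_nonpos (by positivity) (by linarith)
      rw [max_eq_left ((min_le_right _ _).trans this), mul_zero]
  · simp only [hf, hρ']
    split_ifs with h
    · have : 0 ≤ (m : ℝ) * (x - e) := mul_nonneg (by positivity) (by linarith)
      rw [min_eq_left (by linarith), max_eq_right zero_le_one, mul_one]
    · exact mul_nonneg (hφ0 x) (le_max_left _ _)

end Laplace

end LargeGaps

/-! ### Mean values of trigonometric sums. -/

namespace LargeGaps

open Filter Topology MeasureTheory Set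

lemma abs_integral_cos_mul_le {α : ℝ} (hα : α ≠ 0) (A B : ℝ) :
    |∫ t in A..B, Real.cos (α * t)| ≤ 2 / |α| := by
  rw [intervalIntegral.integral_comp_mul_left (fun t => Real.cos t) hα, integral_cos, smul_eq_mul,
    abs_mul, abs_inv, div_eq_inv_mul]
  gcongr
  refine (abs_sub _ _).trans ?_
  linarith [Real.abs_sin_le_one (α * B), Real.abs_sin_le_one (α * A)]

lemma norm_sq_trigSum (S : Finset ℕ) (c θ : ℕ → ℝ) (t : ℝ) :
    ‖∑ n ∈ S, (c n : ℂ) * Complex.exp (-((θ n * t : ℝ) * Complex.I))‖ ^ 2 =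
      ∑ m ∈ S, ∑ n ∈ S, c m * c n * Real.cos ((θ m - θ n) * t) := by
  have h (n : ℕ) : (c n : ℂ) * Complex.exp (-((θ n * t : ℝ) * Complex.I)) =
      (c n * Real.cos (θ n * t) : ℝ) + ((-(c n * Real.sin (θ n * t)) : ℝ) : ℂ) * Complex.I := by
    rw [← neg_mul, ← Complex.ofReal_neg, Complex.exp_ofReal_mul_I, Real.cos_neg, Real.sin_neg]
    push_cast
    ring
  simp only [h]
  rw [Finset.sum_add_distrib, ← Finset.sum_mul, ← Complex.ofReal_sum, ← Complex.ofReal_sum,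
    ← Complex.normSq_eq_norm_sq, Complex.normSq_add_mul_I, Finset.sum_neg_distrib, neg_sq, sq, sq,
    Finset.sum_mul_sum, Finset.sum_mul_sum, ← Finset.sum_add_distrib]
  refine Finset.sum_congr rfl fun m _ => ?_
  rw [← Finset.sum_add_distrib]
  refine Finset.sum_congr rfl fun n _ => ?_
  rw [sub_mul, Real.cos_sub]
  ring

/-- Mean value of a trigonometric sum with `δ`-separated frequencies. -/
lemma abs_integral_norm_sq_trigSum_sub_le (S : Finset ℕ) (c θ : ℕ → ℝ) {δ : ℝ} (hδ : 0 < δ)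
    (hθ : ∀ m ∈ S, ∀ n ∈ S, m ≠ n → δ ≤ |θ m - θ n|) (A B : ℝ) :
    |(∫ t in A..B, ‖∑ n ∈ S, (c n : ℂ) * Complex.exp (-((θ n * t : ℝ) * Complex.I))‖ ^ 2) -
      (B - A) * ∑ n ∈ S, c n ^ 2| ≤ 2 / δ * S.card * ∑ n ∈ S, c n ^ 2 := by
  have hint (m n : ℕ) : IntervalIntegrable
      (fun t => c m * c n * Real.cos ((θ m - θ n) * t)) volume A B :=
    Continuous.intervalIntegrable (by fun_prop) _ _
  have h1 : (∫ t in A..B,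
      ‖∑ n ∈ S, (c n : ℂ) * Complex.exp (-((θ n * t : ℝ) * Complex.I))‖ ^ 2) =
      ∑ m ∈ S, ∑ n ∈ S, c m * c n * ∫ t in A..B, Real.cos ((θ m - θ n) * t) := by
    simp only [norm_sq_trigSum]
    rw [intervalIntegral.integral_finsetSum fun m _ =>
      Continuous.intervalIntegrable (by fun_prop) _ _]
    refine Finset.sum_congr rfl fun m _ => ?_
    rw [intervalIntegral.integral_finsetSum fun n _ => hint m n]
    simp only [intervalIntegral.integral_const_mul]
  have h2 : (B - A) * ∑ n ∈ S, c n ^ 2 =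
      ∑ m ∈ S, ∑ n ∈ S, if m = n then c m * c n * (B - A) else 0 := by
    rw [Finset.mul_sum]
    refine Finset.sum_congr rfl fun m hm => ?_
    rw [Finset.sum_ite_eq, if_pos hm]
    ring
  rw [h1, h2, ← Finset.sum_sub_distrib]
  simp only [← Finset.sum_sub_distrib]
  -- Diagonal pairs cancel exactly and each other pair costs at most `2 / δ`; Cauchy–Schwarz then
  -- yields the factor `S.card`.
  calc _ ≤ ∑ m ∈ S, ∑ n ∈ S, |c m| * |c n| * (2 / δ) := by
        refine (Finset.abs_sum_le_sum_abs _ _).trans (Finset.sum_le_sum fun m hm => ?_)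
        refine (Finset.abs_sum_le_sum_abs _ _).trans (Finset.sum_le_sum fun n hn => ?_)
        split_ifs with h
        · subst h
          simp only [sub_self, zero_mul, Real.cos_zero, intervalIntegral.integral_const,
            smul_eq_mul, mul_one, abs_zero]
          positivity
        · have hd := hθ m hm n hn h
          rw [sub_zero, abs_mul, abs_mul]
          gcongr
          refine (abs_integral_cos_mul_le (fun h0 => ?_) A B).trans (by gcongr)
          rw [h0, abs_zero] at hd
          linarith
    _ = 2 / δ * (∑ n ∈ S, |c n|) ^ 2 := by
        rw [sq, Finset.sum_mul_sum, mul_comm, Finset.sum_mul]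
        simp only [Finset.sum_mul]
    _ ≤ 2 / δ * (S.card * ∑ n ∈ S, |c n| ^ 2) := by
        gcongr
        exact sq_sum_le_card_mul_sum_sq
    _ = _ := by simp only [sq_abs]; ring

/-- For `n < m`, `log (m / n) ≥ 1 - n / m ≥ 1 / m ≥ 1 / N`. -/
lemma one_div_le_abs_log_sub_log {N m n : ℕ} (hm : m ∈ Finset.Icc 1 N) (hn : n ∈ Finset.Icc 1 N)
    (hmn : m ≠ n) : 1 / (N : ℝ) ≤ |Real.log m - Real.log n| := by
  wlog h : n < m generalizing m n
  · rw [abs_sub_comm]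
    exact this hn hm hmn.symm (by omega)
  rw [Finset.mem_Icc] at hm hn
  have hm0 : (0 : ℝ) < m := by exact_mod_cast hm.1
  have hn0 : (0 : ℝ) < n := by exact_mod_cast hn.1
  have hmN : (m : ℝ) ≤ N := by exact_mod_cast hm.2
  have hnm : (n : ℝ) + 1 ≤ m := by exact_mod_cast h
  refine le_trans ?_ (le_abs_self _)
  rw [← Real.log_div hm0.ne' hn0.ne']
  refine le_trans ?_ (Real.one_sub_inv_le_log_of_pos (by positivity))
  calc 1 / (N : ℝ) ≤ 1 / m := by gcongr
    _ ≤ 1 - ((m : ℝ) / n)⁻¹ := by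
      rw [inv_div, one_sub_div hm0.ne']
      gcongr
      linarith

/-! ### Mean square of `H₁` and asymptotics of its diagonal. -/

/-- The diagonal contribution `∑_{n ≤ y} d_{r+1}(n)² P[n]² / n` to the mean square of `H₁`. -/
noncomputable def diagonal (r : ℕ) (P : Polynomial ℝ) (y : ℝ) : ℝ :=
  ∑ n ∈ Finset.Icc 1 ⌊y⌋₊, (d (r + 1) n : ℝ) ^ 2 / n * weight P y n ^ 2

lemma diagonal_nonneg (r : ℕ) (P : Polynomial ℝ) (y : ℝ) : 0 ≤ diagonal r P y :=
  Finset.sum_nonneg fun _ _ => by positivity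

lemma H₁_eq_trigSum (r : ℕ) (P : Polynomial ℝ) (y t : ℝ) :
    H₁ r P y (1 / 2 + Complex.I * (t : ℂ)) = ∑ n ∈ Finset.Icc 1 ⌊y⌋₊,
      ((d (r + 1) n * weight P y n / √n : ℝ) : ℂ) *
        Complex.exp (-((Real.log n * t : ℝ) * Complex.I)) := by
  refine Finset.sum_congr rfl fun n hn => ?_
  have hn0 : (n : ℂ) ≠ 0 := by
    have := (Finset.mem_Icc.1 hn).1
    exact_mod_cast (by omega : n ≠ 0)
  have hsqrt : (n : ℂ) ^ (1 / 2 : ℂ) = ((√n : ℝ) : ℂ) := by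
    rw [Real.sqrt_eq_rpow, Complex.ofReal_cpow (by positivity)]
    simp
  rw [Complex.cpow_add _ _ hn0, hsqrt, Complex.cpow_def_of_ne_zero hn0, Complex.exp_neg,
    ← Complex.natCast_log]
  push_cast
  rw [div_mul_eq_div_div, div_eq_mul_inv _ (Complex.exp _),
    show Complex.log n * (Complex.I * t) = Complex.log n * t * Complex.I by ring]

/-- The spacing `1 / ⌊y⌋₊` and the number of terms `⌊y⌋₊` each contribute a factor of at most `y`.
-/
lemma abs_integral_norm_H₁_sq_sub_le (r : ℕ) (P : Polynomial ℝ) {y : ℝ} (hy : 1 ≤ y) (T : ℝ) :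
    |(∫ t in T..(2 * T), ‖H₁ r P y (1 / 2 + Complex.I * (t : ℂ))‖ ^ 2) - T * diagonal r P y| ≤
      2 * y ^ 2 * diagonal r P y := by
  have hN : 0 < ⌊y⌋₊ := Nat.floor_pos.2 hy
  have hNy : (⌊y⌋₊ : ℝ) ≤ y := Nat.floor_le (by linarith)
  have hN' : (0 : ℝ) < ⌊y⌋₊ := by exact_mod_cast hN
  have h := abs_integral_norm_sq_trigSum_sub_le (Finset.Icc 1 ⌊y⌋₊)
    (fun n => d (r + 1) n * weight P y n / √n) (fun n => Real.log n)
    (δ := 1 / (⌊y⌋₊ : ℝ)) (by positivity)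
    (fun m hm n hn hmn => one_div_le_abs_log_sub_log hm hn hmn) T (2 * T)
  have hD : ∑ n ∈ Finset.Icc 1 ⌊y⌋₊, (d (r + 1) n * weight P y n / √n) ^ 2 = diagonal r P y := by
    refine Finset.sum_congr rfl fun n _ => ?_
    rw [div_pow, Real.sq_sqrt (by positivity)]
    ring
  simp only [← H₁_eq_trigSum] at h
  rw [hD, show 2 * T - T = T by ring] at h
  refine h.trans (mul_le_mul_of_nonneg_right ?_ (diagonal_nonneg r P y))
  rw [Nat.card_Icc, Nat.add_sub_cancel, div_div_eq_mul_div, div_one, mul_assoc, ← sq]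
  gcongr

lemma d_sq_div_rpow_eq (k n : ℕ) (s : ℝ) :
    (d k n : ℝ) ^ 2 / (n : ℝ) ^ (1 + s) =
      (d k n : ℝ) ^ 2 / n * Real.exp (-(s * Real.log n)) := by
  rcases eq_or_ne n 0 with rfl | hn
  · simp [d_apply_zero]
  · have hn' : (0 : ℝ) < n := by positivity
    rw [Real.rpow_add hn', Real.rpow_one, Real.rpow_def_of_pos hn', Real.exp_neg, mul_comm s,
      div_mul_eq_div_div, div_eq_mul_inv _ (Real.exp _)]

/-- Puts the diagonal in Karamata's form, with `s = 1 / log y`, `l n = log n` and `ψ u = P (1 - u) ^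
2`. -/
lemma diagonal_eq_tsum (r : ℕ) (P : Polynomial ℝ) {y : ℝ} (hy : 1 < y) :
    diagonal r P y = ∑' n : ℕ, if (Real.log y)⁻¹ * Real.log n ≤ 1 then
      (d (r + 1) n : ℝ) ^ 2 / n * P.eval (1 - (Real.log y)⁻¹ * Real.log n) ^ 2 else 0 := by
  have hL : 0 < Real.log y := Real.log_pos hy
  have hy0 : 0 < y := by linarith
  rw [tsum_eq_sum (s := Finset.Icc 1 ⌊y⌋₊)]
  · refine Finset.sum_congr rfl fun n hn => ?_
    rw [Finset.mem_Icc, Nat.le_floor_iff hy0.le] at hn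
    have hn0 : (0 : ℝ) < n := by exact_mod_cast hn.1
    rw [if_pos, weight, Real.log_div hy0.ne' hn0.ne', sub_div, div_self hL.ne',
      div_eq_inv_mul (Real.log n)]
    rw [inv_mul_le_iff₀ hL, mul_one]
    exact Real.log_le_log hn0 hn.2
  · intro n hn
    -- As `Real.log 0 = 0`, the index `0` passes the truncation test; its term vanishes because `d
    -- (r + 1) 0 = 0`.
    rcases Nat.eq_zero_or_pos n with rfl | hn0
    · simp [d_apply_zero]
    · have hn0' : (0 : ℝ) < n := by exact_mod_cast hn0
      rw [if_neg]
      rw [inv_mul_le_iff₀ hL, mul_one, Real.log_le_log_iff hn0' hy0, ← Nat.le_floor_iff hy0.le]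
      exact fun h => hn (Finset.mem_Icc.2 ⟨hn0, h⟩)

lemma tendsto_diagonal (r : ℕ) (P : Polynomial ℝ) :
    Tendsto (fun y : ℝ => diagonal r P y / Real.log y ^ ((r + 1) ^ 2)) atTop
      (𝓝 (a (r + 1) * ((Real.Gamma (((r + 1) ^ 2 : ℕ) : ℝ))⁻¹ *
        ∫ x in (0 : ℝ)..1, (1 - x) ^ ((r + 1) ^ 2 - 1) * P.eval x ^ 2))) := by
  have hA := tendsto_pow_mul_tsum_d_sq r
  simp only [d_sq_div_rpow_eq] at hA
  have h := tendsto_tsum_truncated (K := (r + 1) ^ 2)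
    (c := fun n => (d (r + 1) n : ℝ) ^ 2 / n) (l := fun n => Real.log n) (by positivity)
    (fun n => by positivity) (fun n => Real.log_natCast_nonneg n)
    (fun s hs => (summable_d_sq_div_rpow (r + 1) (by linarith : 1 < 1 + s)).congr
      fun n => d_sq_div_rpow_eq (r + 1) n s) hA
    (ψ := fun u => P.eval (1 - u) ^ 2) (by fun_prop) (fun u => sq_nonneg _)
  have hint : ∫ x in (0 : ℝ)..1, (1 - x) ^ ((r + 1) ^ 2 - 1) * P.eval x ^ 2 =
      ∫ u in (0 : ℝ)..1, u ^ ((r + 1) ^ 2 - 1) * P.eval (1 - u) ^ 2 := by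
    have := intervalIntegral.integral_comp_sub_left (a := 0) (b := 1)
      (fun x : ℝ => (1 - x) ^ ((r + 1) ^ 2 - 1) * P.eval x ^ 2) 1
    simpa using this.symm
  rw [hint]
  refine (h.comp (tendsto_inv_atTop_nhdsGT_zero.comp Real.tendsto_log_atTop)).congr' ?_
  filter_upwards [eventually_gt_atTop 1] with y hy
  rw [diagonal_eq_tsum r P hy]
  simp only [Function.comp]
  rw [inv_pow, div_eq_inv_mul]

/-- A nonzero polynomial has finitely many roots, so the continuous nonnegative integrand is
positive somewhere in `(0, 1)`. -/
lemma integral_weight_pos (m : ℕ) {P : Polynomial ℝ} (hP : P ≠ 0) :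
    0 < ∫ x in (0 : ℝ)..1, (1 - x) ^ m * P.eval x ^ 2 := by
  have hne : ((Ioo (0 : ℝ) 1) \ (P.roots.toFinset : Set ℝ)).Nonempty :=
    ((Ioo_infinite zero_lt_one).sdiff (Finset.finite_toSet _)).nonempty
  obtain ⟨x, hx, hxr⟩ := hne
  have hx0 : P.eval x ≠ 0 := fun h => hxr (by simp [hP, h])
  have hx1 : 0 < 1 - x := by linarith [hx.2]
  refine intervalIntegral.integral_pos zero_lt_one (by fun_prop) (fun z hz => ?_)
    ⟨x, Ioo_subset_Icc_self hx, by positivity⟩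
  have : 0 ≤ 1 - z := by linarith [hz.2]
  positivity

lemma tendsto_integral_norm_H₁_sq (r : ℕ) (P : Polynomial ℝ) {ϑ : ℝ} (hϑ₀ : 0 < ϑ)
    (hϑ₁ : ϑ < 1 / 2) :
    Tendsto (fun T : ℝ =>
      (∫ t in T..(2 * T), ‖H₁ r P (T ^ ϑ) (1 / 2 + Complex.I * (t : ℂ))‖ ^ 2) /
        (T * Real.log (T ^ ϑ) ^ ((r + 1) ^ 2))) atTop
      (𝓝 (a (r + 1) * ((Real.Gamma (((r + 1) ^ 2 : ℕ) : ℝ))⁻¹ *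
        ∫ x in (0 : ℝ)..1, (1 - x) ^ ((r + 1) ^ 2 - 1) * P.eval x ^ 2))) := by
  have hD := (tendsto_diagonal r P).comp (tendsto_rpow_atTop hϑ₀)
  -- This is `2 y² / T`, the error relative to the main term; it tends to `0` since `ϑ < 1 / 2`.
  have hpow : Tendsto (fun T : ℝ => 2 * T ^ (-(1 - 2 * ϑ))) atTop (𝓝 0) := by
    simpa using (tendsto_rpow_neg_atTop (by linarith : 0 < 1 - 2 * ϑ)).const_mul 2
  have herr := hpow.mul hD
  rw [zero_mul] at herr
  have hsub := squeeze_zero_norm' (f := fun T : ℝ =>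
    (∫ t in T..(2 * T), ‖H₁ r P (T ^ ϑ) (1 / 2 + Complex.I * (t : ℂ))‖ ^ 2) /
      (T * Real.log (T ^ ϑ) ^ ((r + 1) ^ 2)) -
        diagonal r P (T ^ ϑ) / Real.log (T ^ ϑ) ^ ((r + 1) ^ 2)) ?_ herr
  · simpa using hsub.add hD
  · filter_upwards [eventually_gt_atTop 1] with T hT
    have hT0 : 0 < T := by linarith
    have hy : 1 < T ^ ϑ := Real.one_lt_rpow hT hϑ₀
    have hL : 0 < Real.log (T ^ ϑ) ^ ((r + 1) ^ 2) := pow_pos (Real.log_pos hy) _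
    have hrw : T ^ (-(1 - 2 * ϑ)) = (T ^ ϑ) ^ 2 / T := by
      rw [neg_sub, Real.rpow_sub hT0, Real.rpow_one, mul_comm 2 ϑ, Real.rpow_mul hT0.le,
        Real.rpow_ofNat]
    have h := abs_integral_norm_H₁_sq_sub_le r P hy.le T
    rw [← mul_div_mul_left (diagonal r P (T ^ ϑ)) _ hT0.ne', ← sub_div, Real.norm_eq_abs, abs_div,
      abs_of_pos (mul_pos hT0 hL), hrw]
    calc _ ≤ 2 * (T ^ ϑ) ^ 2 * diagonal r P (T ^ ϑ) /
          (T * Real.log (T ^ ϑ) ^ ((r + 1) ^ 2)) := by gcongr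
      _ = _ := by simp only [Function.comp]; field_simp

end LargeGaps

theorem lemma2p1 (r : ℕ) (hr : 1 ≤ r) (P₁ : Polynomial ℝ) (ϑ : ℝ) (hϑ₀ : 0 < ϑ)
    (hϑ₁ : ϑ < 1 / 2) :
    (∀ p : Nat.Primes, Summable (fun n : ℕ => LargeGaps.localTerm (r + 1) p n)) ∧
    Multipliable (fun p : Nat.Primes => LargeGaps.eulerFactor (r + 1) p) ∧
    Asymptotics.IsEquivalent Filter.atTop
      (fun T : ℝ =>
        ∫ t in T..(2 * T),
          ‖LargeGaps.H₁ r P₁ (T ^ ϑ) (1 / 2 + Complex.I * (t : ℂ))‖ ^ 2)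
      (fun T : ℝ =>
        LargeGaps.a (r + 1) * T * Real.log (T ^ ϑ) ^ ((r + 1) ^ 2)
            / Real.Gamma (((r + 1) ^ 2 : ℕ) : ℝ)
          * ∫ x in (0 : ℝ)..1, (1 - x) ^ ((r + 1) ^ 2 - 1) * P₁.eval x ^ 2) := by
  refine ⟨LargeGaps.summable_localTerm r, LargeGaps.multipliable_eulerFactor r, ?_⟩
  -- For `P₁ = 0` the limiting constant is `0` and cannot be divided by, but both sides vanish
  -- identically.
  by_cases hP : P₁ = 0
  · subst hP
    simp [LargeGaps.H₁, LargeGaps.weight, Asymptotics.IsEquivalent.refl]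
  · have hlim := LargeGaps.tendsto_integral_norm_H₁_sq r P₁ hϑ₀ hϑ₁
    have ha := LargeGaps.a_succ_pos r
    have hI := LargeGaps.integral_weight_pos ((r + 1) ^ 2 - 1) hP
    have hG : 0 < Real.Gamma (((r + 1) ^ 2 : ℕ) : ℝ) := Real.Gamma_pos_of_pos (by positivity)
    have hC := mul_pos ha (mul_pos (inv_pos.2 hG) hI)
    have hlog : ∀ᶠ T : ℝ in Filter.atTop, 0 < T * Real.log (T ^ ϑ) ^ ((r + 1) ^ 2) := by
      filter_upwards [Filter.eventually_gt_atTop 1] with T hT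
      exact mul_pos (by linarith) (pow_pos (Real.log_pos (Real.one_lt_rpow hT hϑ₀)) _)
    refine (Asymptotics.isEquivalent_iff_tendsto_one ?_).2 ?_
    · filter_upwards [hlog] with T hT h0
      refine (mul_pos hT hC).ne' (Eq.trans ?_ h0)
      field_simp
    · have h1 := hlim.div_const (LargeGaps.a (r + 1) *
        ((Real.Gamma (((r + 1) ^ 2 : ℕ) : ℝ))⁻¹ *
          ∫ x in (0 : ℝ)..1, (1 - x) ^ ((r + 1) ^ 2 - 1) * P₁.eval x ^ 2))
      rw [div_self hC.ne'] at h1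
      refine h1.congr fun T => ?_
      rw [Pi.div_apply, div_div]
      congr 1
      field_simp
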